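/- Let $Y_1,\dots,Y_K\in\mathbb{R}^2$ ($K\ge 1$) be distinct points in the interior of a closed bounded region $\Omega\subset\mathbb{R}^2$ whose boundary is a finite union of straight line segments. Let $S(X)=\min_k\|X-Y_k\|$ be the distance transform, and assume that every Voronoi cell $V_k=\{X\in\Omega:\|X-Y_k\|\le\|X-Y_j\|\ \forall j\}$ is convex (as is the case when $\Omega$ is convex). For $\theta\in\mathbb{R}$ put $e(\theta)=(\cos\theta,\sin\theta)$ and let $R_k(\theta)=\sup\{r\ge0: Y_k+r\,e(\theta)\in V_k\}$ be the length of the ray of $V_k$ from $Y_k$ at orientation $\theta$. For $0<\epsilon<\frac12$ let $$\Omega^\epsilon=\bigcup_{k=1}^K\{Y_k+r\,e(\theta):\ 0\le\theta<2\pi,\ \epsilon R_k(\theta)\le r\le(1-\epsilon)R_k(\theta)\},$$ and let $L$ and $L^\epsilon$ be the areas of $\Omega$ and $\Omega^\epsilon$. For $\tau>0$ define $$F^\epsilon_\tau(u,v)=\frac{1}{2\pi\tau\sqrt{L^\epsilon}}\iint_{\Omega^\epsilon}\exp\left(\frac{iS(x,y)}{\tau}\right)\exp\left(\frac{-i(ux+vy)}{\tau}\right)dx\,dy$$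 and the power spectrum $P^\epsilon_\tau(\tilde r,\omega)=|F^\epsilon_\tau(\tilde r\cos\omega,\tilde r\sin\omega)|^2$. Let $$P(\theta)=\frac1L\sum_{k=1}^K\frac{R_k(\theta)^2}{2}.$$ Let $0<\delta<1$ and $\omega_0\in\mathbb{R}$. Then: (i) $P(\omega_0)$ is the density at $\omega_0$ of the orientation of $\nabla S$ at a uniformly distributed point of $\Omega$, that is, $$P(\omega_0)=\lim_{\Delta\to0^+}\frac{1}{\Delta}\cdot\frac1L\,\mathrm{area}\{X\in\Omega:\ S\text{ is differentiable at }X\text{ and }\nabla S(X)=e(\varphi)\text{ for some }\varphi\in[\omega_0,\omega_0+\Delta]\}.$$ (ii) In the following expression the limit over $\tau$ exists for all $0<\epsilon<\frac12$ and $0<\Delta<2\pi$, the limit over $\Delta$ exists for all $0<\epsilon<\frac12$, the limit over $\epsilon$ exists, and $$\lim_{\epsilon\to0^+}\ \lim_{\Delta\to0^+}\ \frac1\Delta\ \lim_{\tau\to0^+}\int_{\omega_0}^{\omega_0+\Delta}\left\{\int_{1-\delta}^{1+\delta}P^\epsilon_\tau(\tilde r,\omega)\,\tilde r\,d\tilde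 r\right\}d\omega=P(\omega_0).$$ -/

import Mathlib

open Filter Topology MeasureTheory

noncomputable section

namespace DistanceTransform

/-- The Euclidean plane. -/
abbrev Plane : Type := EuclideanSpace ℝ (Fin 2)

/-- The unit vector with orientation `θ`. -/
def dir (θ : ℝ) : Plane := !₂[Real.cos θ, Real.sin θ]

/-- A closed bounded region whose boundary is a finite union of straight line segments. -/
def IsPolygonalRegion (Ω : Set Plane) : Prop :=
  IsCompact Ω ∧ ∃ E : Finset (Plane × Plane), frontier Ω = ⋃ e ∈ E, segment ℝ e.1 e.2

variable {K : ℕ}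

/-- The distance transform `S(X) = min_k ‖X - Y_k‖`. -/
def distTransform (Y : Fin K → Plane) (X : Plane) : ℝ := ⨅ k, ‖X - Y k‖

/-- The part of `Ω` in which `Y k` is a nearest point of `Y`
(in absolute coordinates, i.e. not translated to the origin). -/
def voronoiCell (Ω : Set Plane) (Y : Fin K → Plane) (k : Fin K) : Set Plane :=
  {X | X ∈ Ω ∧ ∀ j, ‖X - Y k‖ ≤ ‖X - Y j‖}

/-- The length of the ray from `Y k` with orientation `θ` inside the `k`-th Voronoi cell. -/
def rayLength (Ω : Set Plane) (Y : Fin K → Plane) (k : Fin K) (θ : ℝ) : ℝ :=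
  sSup {r : ℝ | 0 ≤ r ∧ Y k + r • dir θ ∈ voronoiCell Ω Y k}

/-- The `k`-th Voronoi cell with a neighbourhood of its centre and of its boundary removed:
on the ray with orientation `θ` the radius runs through `[ε R_k(θ), (1 - ε) R_k(θ)]`. -/
def shrunkCell (Ω : Set Plane) (Y : Fin K → Plane) (ε : ℝ) (k : Fin K) : Set Plane :=
  {X | ∃ θ ∈ Set.Ico 0 (2 * Real.pi),
    ∃ r ∈ Set.Icc (ε * rayLength Ω Y k θ) ((1 - ε) * rayLength Ω Y k θ),
      X = Y k + r • dir θ}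

/-- The region `Ω^ε`. -/
def shrunkRegion (Ω : Set Plane) (Y : Fin K → Plane) (ε : ℝ) : Set Plane :=
  ⋃ k, shrunkCell Ω Y ε k

/-- Lebesgue area of a plane set. -/
def area (A : Set Plane) : ℝ := (volume A).toReal

/-- The normalised Fourier transform `F_τ^ε(u, v)` over `Ω^ε` of the complex wave
`exp (i S / τ)`; here `l^ε` is the square root of the area of `Ω^ε`. -/
def waveFourier (Ω : Set Plane) (Y : Fin K → Plane) (ε τ u v : ℝ) : ℂ :=
  ((1 / (2 * Real.pi * τ * Real.sqrt (area (shrunkRegion Ω Y ε))) : ℝ) : ℂ) *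
    ∫ X in shrunkRegion Ω Y ε,
      Complex.exp (Complex.I * ((distTransform Y X / τ : ℝ) : ℂ)) *
        Complex.exp (-Complex.I * (((u * X 0 + v * X 1) / τ : ℝ) : ℂ))

/-- The power spectrum `P_τ^ε(r, ω) = |F_τ^ε(r cos ω, r sin ω)|²` in polar coordinates. -/
def powerSpectrum (Ω : Set Plane) (Y : Fin K → Plane) (ε τ r ω : ℝ) : ℝ :=
  ‖waveFourier Ω Y ε τ (r * Real.cos ω) (r * Real.sin ω)‖ ^ 2

/-- The probability that the gradient of `S` at a uniformly distributed point of `Ω`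
has an orientation in `[θ, θ + Δ]`. -/
def orientationProb (Ω : Set Plane) (Y : Fin K → Plane) (θ Δ : ℝ) : ℝ :=
  1 / area Ω *
    area {X | X ∈ Ω ∧ ∃ φ ∈ Set.Icc θ (θ + Δ), HasGradientAt (distTransform Y) (dir φ) X}

/-- The closed form `P(θ) = (1/L) ∑_k R_k(θ)² / 2` of the gradient orientation density. -/
def gradientDensity (Ω : Set Plane) (Y : Fin K → Plane) (θ : ℝ) : ℝ :=
  1 / area Ω * ∑ k, rayLength Ω Y k θ ^ 2 / 2

end DistanceTransform

end

noncomputable section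

namespace DistanceTransform

/-! ### Plancherel's theorem and autocorrelation -/

section Plancherel
open FourierTransform
open scoped RealInnerProductSpace ComplexConjugate

variable {V : Type*} [NormedAddCommGroup V] [InnerProductSpace ℝ V] [MeasurableSpace V]
  [BorelSpace V] [FiniteDimensional ℝ V]

/-! Fix `ε` and read `P^ε_τ` as a density on the frequency plane. By Plancherel its characteristic
function at `t` is the normalised autocorrelation of the wave `exp (i S / τ)`, cut off to `Ω^ε`, at
lag `τ t` (`charFun_spectralMeasure`). At lag `0` this is `1`, so the density is a probability
density. As `τ → 0+` the integrand of the autocorrelation is `exp (i (S (X + τ t) - S X) / τ)` near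
almost every point of `Ω^ε` and tends to `exp (i ⟪∇S X, t⟫)`; dominated convergence gives the
characteristic function of `∇S` at a uniform point of `Ω^ε` (`tendsto_autocorrelation_cutoffWave`).
Lévy's continuity theorem turns this into weak convergence, with no stationary phase expansion.

The limit law lives on the unit circle, since `∇S` is almost everywhere the unit vector pointing
away from the nearest site. The annular sector of integration has frontier meeting the circle in at
most two points, to which only finitely many lines of points `X` are sent. The portmanteau theorem
therefore applies (`tendsto_setIntegral_wavePower`).

It remains to compute areas. In polar coordinates around `Y_k`, the part of the shell `[a, b]` of a
cell seen under orientations in an interval has area `(b² - a²) ∫ R_k² / 2` (`volume_sectorShell`).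
For `a = ε`, `b = 1 - ε` the factor is `1 - 2ε`, whatever the orientation, and it cancels against
`L^ε = (1 - 2ε) L`. Hence the limit over `τ` is `∫ P` for every `ε`, and continuity of `P` gives the
limit over `Δ`. The same area formula with `a = 0`, `b = 1` gives (i). -/

theorem continuous_fourier_of_integrable {f : V → ℂ} (hf : Integrable f) : Continuous (𝓕 f) :=
  VectorFourier.fourierIntegral_continuous Real.continuous_fourierChar continuous_inner hf

/-- On `L¹ ∩ L²` the Fourier transform of `L²` is given by the Fourier integral. -/
theorem fourier_toLp_ae_eq {f : V → ℂ} (hf : Integrable f) (hf2 : MemLp f 2) :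
    (𝓕 (hf2.toLp f) : Lp ℂ 2 (volume : Measure V)) =ᵐ[volume] 𝓕 f := by
  -- Two locally integrable functions agree almost everywhere once they agree against all smooth
  -- compactly supported `g`. For both transforms the Fourier transform can be moved onto `g`.
  refine ae_eq_of_integral_contDiff_smul_eq
    ((Lp.memLp (𝓕 (hf2.toLp f) : Lp ℂ 2 (volume : Measure V))).locallyIntegrable one_le_two)
    (continuous_fourier_of_integrable hf).locallyIntegrable fun g hg hgs => ?_
  have hc : HasCompactSupport (fun x => (g x : ℂ)) :=
    hgs.comp_left (g := ((↑) : ℝ → ℂ)) Complex.ofReal_zero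
  have hd : ContDiff ℝ (↑(⊤ : ℕ∞)) (fun x => (g x : ℂ)) := Complex.ofRealCLM.contDiff.comp hg
  set φ : SchwartzMap V ℂ := hc.toSchwartzMap hd
  have hφ : ∀ x, φ x = (g x : ℂ) := fun x => rfl
  have h1 := congrArg (fun T : TemperedDistribution V ℂ => T φ)
    (Lp.fourier_toTemperedDistribution_eq (hf2.toLp f))
  simp only [TemperedDistribution.fourier_apply, Lp.toTemperedDistribution_apply] at h1
  have h2 := VectorFourier.integral_fourierIntegral_smul_eq_flip (L := innerₗ V)
    Real.continuous_fourierChar continuous_inner hf φ.integrable (ν := volume)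
  calc _ = ∫ x, φ x • (𝓕 (hf2.toLp f) : Lp ℂ 2 (volume : Measure V)) x := by
        simp [hφ]
    _ = ∫ x, (𝓕 φ) x • (hf2.toLp f) x := h1.symm
    _ = ∫ x, f x • (𝓕 (φ : V → ℂ)) x := by
        refine integral_congr_ae ?_
        filter_upwards [hf2.coeFn_toLp] with x hx
        rw [hx, SchwartzMap.fourier_coe, smul_eq_mul, smul_eq_mul, mul_comm]
    _ = ∫ x, (𝓕 f) x • φ x := by
        rw [flip_innerₗ] at h2
        exact h2.symm
    _ = _ := by
        refine integral_congr_ae (ae_of_all _ fun x => ?_)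
        simp [hφ, mul_comm]

theorem memLp_fourier {f : V → ℂ} (hf : Integrable f) (hf2 : MemLp f 2) : MemLp (𝓕 f) 2 :=
  (memLp_congr_ae (fourier_toLp_ae_eq hf hf2)).1 (Lp.memLp _)

/-- Plancherel's theorem for the Fourier integral on `L¹ ∩ L²`. -/
theorem integral_conj_fourier_mul_fourier {f g : V → ℂ} (hf : Integrable f) (hf2 : MemLp f 2)
    (hg : Integrable g) (hg2 : MemLp g 2) :
    ∫ w, conj (𝓕 f w) * 𝓕 g w = ∫ x, conj (f x) * g x := by
  have h := Lp.inner_fourier_eq (hf2.toLp f) (hg2.toLp g)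
  rw [L2.inner_def, L2.inner_def] at h
  calc _ = _ := ?_
    _ = _ := h
    _ = _ := ?_
  · refine integral_congr_ae ?_
    filter_upwards [fourier_toLp_ae_eq hf hf2, fourier_toLp_ae_eq hg hg2] with x h1 h2
    rw [h1, h2, RCLike.inner_apply, mul_comm]
  · refine integral_congr_ae ?_
    filter_upwards [hf2.coeFn_toLp, hg2.coeFn_toLp] with x h1 h2
    rw [h1, h2, RCLike.inner_apply, mul_comm]

theorem fourier_comp_add_right (f : V → ℂ) (a w : V) :
    𝓕 (fun x => f (x + a)) w = Complex.exp (2 * Real.pi * ⟪a, w⟫ * Complex.I) * 𝓕 f w := by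
  have h := congrFun
    (VectorFourier.fourierIntegral_comp_add_right Real.fourierChar volume (innerₗ V) f a) w
  refine h.trans ?_
  rw [Circle.smul_def, Real.fourierChar_apply, smul_eq_mul]
  simp only [innerₗ_apply_apply, Complex.ofReal_mul, Complex.ofReal_ofNat]
  rfl

/-- The characteristic function of the rescaled power spectrum is the autocorrelation. -/
theorem integral_norm_sq_fourier_mul_exp {f : V → ℂ} (hf : Integrable f) (hf2 : MemLp f 2)
    (a : V) :
    ∫ w, ((‖𝓕 f w‖ ^ 2 : ℝ) : ℂ) * Complex.exp (2 * Real.pi * ⟪a, w⟫ * Complex.I) =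
      ∫ x, conj (f x) * f (x + a) := by
  rw [← integral_conj_fourier_mul_fourier hf hf2 (hf.comp_add_right a)
    (hf2.comp_measurePreserving (measurePreserving_add_right volume a))]
  refine integral_congr_ae (ae_of_all _ fun w => ?_)
  beta_reduce
  rw [fourier_comp_add_right, mul_left_comm, Complex.conj_mul']
  push_cast
  ring

theorem integrable_norm_sq_fourier {f : V → ℂ} (hf : Integrable f) (hf2 : MemLp f 2) :
    Integrable fun w => ‖𝓕 f w‖ ^ 2 :=
  (memLp_two_iff_integrable_sq_norm
    (continuous_fourier_of_integrable hf).aestronglyMeasurable).1 (memLp_fourier hf hf2)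

end Plancherel

/-! ### Sectors and polar coordinates -/

section Polar

open scoped RealInnerProductSpace ENNReal

theorem continuous_dir : Continuous dir := by
  unfold dir
  fun_prop

theorem norm_dir (θ : ℝ) : ‖dir θ‖ = 1 := by
  simp [dir, EuclideanSpace.norm_eq]

theorem inner_dir_dir (θ φ : ℝ) : ⟪dir θ, dir φ⟫ = Real.cos (θ - φ) := by
  simp [dir, PiLp.inner_apply, Fin.sum_univ_two, Real.cos_sub]
  ring

theorem orthonormalBasisOneI_repr_exp (r θ : ℝ) :
    Complex.orthonormalBasisOneI.repr ((r : ℂ) * Complex.exp (θ * Complex.I)) = r • dir θ := by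
  ext i
  fin_cases i <;> simp [dir, Complex.exp_ofReal_mul_I_re, Complex.exp_ofReal_mul_I_im]

theorem exists_eq_smul_dir (x : Plane) : ∃ θ ∈ Set.Ico 0 (2 * Real.pi), x = ‖x‖ • dir θ := by
  obtain ⟨z, rfl⟩ := Complex.orthonormalBasisOneI.repr.surjective x
  refine ⟨toIcoMod Real.two_pi_pos 0 z.arg, by simpa using toIcoMod_mem_Ico Real.two_pi_pos 0 z.arg, ?_⟩
  have h : dir (toIcoMod Real.two_pi_pos 0 z.arg) = dir z.arg := by
    rw [toIcoMod]
    simp only [dir, zsmul_eq_mul, Real.cos_sub_int_mul_two_pi, Real.sin_sub_int_mul_two_pi]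
  rw [h, ← orthonormalBasisOneI_repr_exp, LinearIsometryEquiv.norm_map, Complex.norm_mul_exp_arg_mul_I]

/-- Integration in polar coordinates whose angular cut is opposite to the orientation `m`. -/
theorem lintegral_polar (m : ℝ) (f : Plane → ℝ≥0∞) (hf : Measurable f) :
    ∫⁻ X, f X = ∫⁻ θ in Set.Ioo (m - Real.pi) (m + Real.pi),
      ∫⁻ r in Set.Ioi (0 : ℝ), ENNReal.ofReal r * f (r • dir θ) := by
  -- Rotating by `m` moves the cut of the standard polar coordinates from `±π` to `m ± π`, so that
  -- no sector centred at `m` is split by it.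
  set e : ℂ ≃ₗᵢ[ℝ] Plane := (rotation (Circle.exp m)).trans Complex.orthonormalBasisOneI.repr
  have he : ∀ r θ : ℝ, e ((r : ℂ) * (Real.cos θ + Real.sin θ * Complex.I)) = r • dir (θ + m) := by
    intro r θ
    rw [← orthonormalBasisOneI_repr_exp]
    simp only [e, LinearIsometryEquiv.trans_apply, rotation_apply, Circle.coe_exp]
    congr 1
    rw [Complex.ofReal_cos, Complex.ofReal_sin, ← Complex.exp_mul_I]
    push_cast
    rw [add_mul, Complex.exp_add]
    ring
  have hF : Measurable fun p : ℝ × ℝ => ENNReal.ofReal p.2 * f (p.2 • dir p.1) := by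
    refine Measurable.mul (by fun_prop) (hf.comp ?_)
    exact (continuous_snd.smul (continuous_dir.comp continuous_fst)).measurable
  rw [← e.measurePreserving.lintegral_comp hf, ← Complex.lintegral_comp_polarCoord_symm]
  simp only [Complex.polarCoord_symm_apply, he, smul_eq_mul, polarCoord_target]
  rw [Measure.volume_eq_prod, ← Measure.prod_restrict, lintegral_prod_symm']
  · have hmp := (measurePreserving_add_right (volume : Measure ℝ) m).restrict_preimage_emb
      (measurableEmbedding_addRight m) (Set.Ioo (m - Real.pi) (m + Real.pi))
    rw [← hmp.lintegral_comp hF.lintegral_prod_right']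
    congr 3
    ext θ
    simp only [Set.mem_preimage, Set.mem_Ioo]
    constructor <;> rintro ⟨h1, h2⟩ <;> constructor <;> linarith
  · refine Measurable.mul (by fun_prop) (hf.comp ?_)
    exact (continuous_fst.smul (continuous_dir.comp
      (continuous_snd.add continuous_const))).measurable

/-- The closed sector of half-width `h` around the orientation `m`. -/
def sector (m h : ℝ) : Set Plane := {x | Real.cos h * ‖x‖ ≤ ⟪x, dir m⟫}

theorem isClosed_sector (m h : ℝ) : IsClosed (sector m h) :=
  isClosed_le (by fun_prop) (by fun_prop)

theorem cos_le_cos_iff_abs_le {h t : ℝ} (h0 : 0 ≤ h) (hpi : h ≤ Real.pi) (ht : |t| ≤ Real.pi) :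
    Real.cos h ≤ Real.cos t ↔ |t| ≤ h := by
  rw [← Real.cos_abs t]
  exact Real.strictAntiOn_cos.le_iff_ge ⟨h0, hpi⟩ ⟨abs_nonneg t, ht⟩

theorem smul_dir_mem_sector {m h r θ : ℝ} (h0 : 0 ≤ h) (hpi : h ≤ Real.pi) (hr : 0 < r)
    (hθ : |θ - m| ≤ Real.pi) : r • dir θ ∈ sector m h ↔ θ ∈ Set.Icc (m - h) (m + h) := by
  rw [sector, Set.mem_ofPred_eq, real_inner_smul_left, inner_dir_dir, norm_smul, norm_dir,
    Real.norm_of_nonneg hr.le, mul_one, mul_comm, mul_le_mul_iff_right₀ hr,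
    cos_le_cos_iff_abs_le h0 hpi hθ, abs_le, Set.mem_Icc]
  constructor <;> rintro ⟨h1, h2⟩ <;> constructor <;> linarith

theorem smul_mem_sector {m h r : ℝ} {x : Plane} (hr : 0 < r) :
    r • x ∈ sector m h ↔ x ∈ sector m h := by
  rw [sector, Set.mem_ofPred_eq, real_inner_smul_left, norm_smul, Real.norm_of_nonneg hr.le,
    mul_left_comm, mul_le_mul_iff_right₀ hr, Set.mem_ofPred_eq]

theorem sector_pi (m : ℝ) : sector m Real.pi = Set.univ := by
  ext x
  simp only [sector, Real.cos_pi, Set.mem_ofPred_eq, Set.mem_univ, iff_true]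
  have := neg_le_of_abs_le (abs_real_inner_le_norm x (dir m))
  rw [norm_dir] at this
  linarith

theorem exists_dir_eq (m : ℝ) {v : Plane} (hv : ‖v‖ = 1) :
    ∃ θ, |θ - m| ≤ Real.pi ∧ dir θ = v := by
  obtain ⟨θ, -, hθ⟩ := exists_eq_smul_dir v
  rw [hv, one_smul] at hθ
  refine ⟨toIcoMod Real.two_pi_pos (m - Real.pi) θ, ?_, ?_⟩
  · have := toIcoMod_mem_Ico Real.two_pi_pos (m - Real.pi) θ
    rw [abs_le]
    constructor <;> linarith [this.1, this.2]
  · rw [hθ, toIcoMod]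
    simp only [dir, zsmul_eq_mul, Real.cos_sub_int_mul_two_pi, Real.sin_sub_int_mul_two_pi]

/-- Passes from the closed inequality defining a sector to an interval of orientations, which is
only meaningful modulo `2π`. -/
theorem mem_sector_iff_exists_dir {m h : ℝ} (h0 : 0 ≤ h) (hpi : h ≤ Real.pi) {v : Plane}
    (hv : ‖v‖ = 1) : v ∈ sector m h ↔ ∃ φ ∈ Set.Icc (m - h) (m + h), dir φ = v := by
  constructor
  · intro hs
    obtain ⟨θ, h1, rfl⟩ := exists_dir_eq m hv
    rw [← one_smul ℝ (dir θ), smul_dir_mem_sector h0 hpi one_pos h1] at hs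
    exact ⟨θ, hs, rfl⟩
  · rintro ⟨φ, hφ, rfl⟩
    have : |φ - m| ≤ Real.pi := abs_le.2 ⟨by linarith [hφ.1], by linarith [hφ.2]⟩
    rw [← one_smul ℝ (dir φ), smul_dir_mem_sector h0 hpi one_pos this]
    exact hφ

/-- Integral over an annular sector in polar coordinates. -/
theorem lintegral_sector {m h : ℝ} (h0 : 0 ≤ h) (hpi : h ≤ Real.pi) {S : Set Plane}
    (hS : MeasurableSet S) {f : Plane → ℝ≥0∞} (hf : Measurable f) {a b : ℝ → ℝ}
    (ha : ∀ θ, 0 ≤ a θ)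
    (hab : ∀ θ r, 0 < r → (r • dir θ ∈ S ↔ r ∈ Set.Icc (a θ) (b θ))) :
    ∫⁻ X in sector m h ∩ S, f X = ∫⁻ θ in Set.Icc (m - h) (m + h),
      ∫⁻ r in Set.Icc (a θ) (b θ), ENNReal.ofReal r * f (r • dir θ) := by
  have hm := (isClosed_sector m h).measurableSet.inter hS
  rw [← lintegral_indicator hm, lintegral_polar m _ (hf.indicator hm)]
  rw [← setLIntegral_congr (Ioo_ae_eq_Icc (a := m - h)),
    ← lintegral_indicator measurableSet_Ioo, ← lintegral_indicator measurableSet_Ioo]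
  refine lintegral_congr_ae ?_
  -- The extreme orientations are discarded as null: for `h = π` they lie on the cut. The radius `0`
  -- is discarded too, since it may belong to `[a θ, b θ]`.
  have hne : ∀ c : ℝ, ∀ᵐ θ : ℝ, θ ≠ c := fun c => by
    simp [ae_iff]
  filter_upwards [hne (m - h), hne (m + h)] with θ h1 h2
  by_cases hθ : θ ∈ Set.Ioo (m - Real.pi) (m + Real.pi)
  swap
  · rw [Set.indicator_of_notMem hθ, Set.indicator_of_notMem]
    exact fun hh => hθ ⟨by linarith [hh.1], by linarith [hh.2]⟩
  rw [Set.indicator_of_mem hθ]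
  have hθ' : |θ - m| ≤ Real.pi := abs_le.2 ⟨by linarith [hθ.1], by linarith [hθ.2]⟩
  by_cases hs : θ ∈ Set.Ioo (m - h) (m + h)
  · rw [Set.indicator_of_mem hs, ← lintegral_indicator measurableSet_Ioi,
      ← lintegral_indicator measurableSet_Icc]
    refine lintegral_congr_ae ?_
    filter_upwards [hne 0] with r hr
    by_cases hr0 : 0 < r
    · rw [Set.indicator_of_mem (Set.mem_Ioi.2 hr0)]
      by_cases hri : r ∈ Set.Icc (a θ) (b θ)
      · rw [Set.indicator_of_mem hri, Set.indicator_of_mem]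
        exact ⟨(smul_dir_mem_sector h0 hpi hr0 hθ').2 (Set.Ioo_subset_Icc_self hs),
          (hab θ r hr0).2 hri⟩
      · rw [Set.indicator_of_notMem hri, Set.indicator_of_notMem, mul_zero]
        exact fun hh => hri ((hab θ r hr0).1 hh.2)
    · rw [Set.indicator_of_notMem (by simpa using hr0), Set.indicator_of_notMem]
      exact fun hh => hr0 (lt_of_le_of_ne ((ha θ).trans hh.1) (Ne.symm hr))
  · rw [Set.indicator_of_notMem hs]
    refine (lintegral_congr_ae ?_).trans lintegral_zero
    filter_upwards [ae_restrict_mem measurableSet_Ioi] with r hr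
    rw [Set.indicator_of_notMem, mul_zero]
    intro hh
    have := (smul_dir_mem_sector h0 hpi hr hθ').1 hh.1
    exact hs ⟨lt_of_le_of_ne this.1 (Ne.symm h1), lt_of_le_of_ne this.2 h2⟩

end Polar

/-! ### Voronoi cells as convex bodies described by their gauge -/

section Cells

open scoped RealInnerProductSpace ENNReal Pointwise

/-- The points at which the gauge of `C` lies in `[a, b]`. -/
def gaugeShell (C : Set Plane) (a b : ℝ) : Set Plane := {x | gauge C x ∈ Set.Icc a b}

section Gauge
variable {C : Set Plane}

theorem gauge_pos_of_isCompact (hC0 : C ∈ 𝓝 0) (hCc : IsCompact C) {x : Plane} (hx : x ≠ 0) :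
    0 < gauge C x :=
  (gauge_pos (absorbent_nhds_zero hC0)
    (NormedSpace.isVonNBounded_iff ℝ |>.2 hCc.isBounded)).2 hx

theorem gauge_dir_pos (hC0 : C ∈ 𝓝 0) (hCc : IsCompact C) (θ : ℝ) : 0 < gauge C (dir θ) :=
  gauge_pos_of_isCompact hC0 hCc (norm_ne_zero_iff.1 (by rw [norm_dir]; exact one_ne_zero))

theorem gauge_le_one_iff_mem (hCv : Convex ℝ C) (hC0 : C ∈ 𝓝 0) (hCc : IsCompact C) (x : Plane) :
    gauge C x ≤ 1 ↔ x ∈ C := by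
  rw [gauge_le_one_iff_mem_closure hCv hC0, hCc.isClosed.closure_eq]

theorem isClosed_gaugeShell (hCv : Convex ℝ C) (hC0 : C ∈ 𝓝 0) (a b : ℝ) :
    IsClosed (gaugeShell C a b) :=
  isClosed_Icc.preimage (continuous_gauge hCv hC0)

/-- The level set is a dilate of the frontier of a convex set, which is null. -/
theorem volume_gauge_eq (hCv : Convex ℝ C) (hC0 : C ∈ 𝓝 0) {c : ℝ} (hc : 0 < c) :
    volume {x | gauge C x = c} = 0 := by
  have h : {x | gauge C x = c} = c • frontier C := by
    ext x
    rw [Set.mem_smul_set_iff_inv_smul_mem₀ hc.ne', ← gauge_eq_one_iff_mem_frontier hCv hC0,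
      gauge_smul_of_nonneg (inv_nonneg.2 hc.le), smul_eq_mul, inv_mul_eq_one₀ hc.ne']
    exact eq_comm
  rw [h, Measure.addHaar_smul, hCv.addHaar_frontier volume, mul_zero]

theorem volume_frontier_gaugeShell (hCv : Convex ℝ C) (hC0 : C ∈ 𝓝 0) {a b : ℝ} (ha : 0 < a)
    (hab : a ≤ b) : volume (frontier (gaugeShell C a b)) = 0 := by
  refine measure_mono_null (t := {x | gauge C x = a} ∪ {x | gauge C x = b}) ?_
    (measure_union_null (volume_gauge_eq hCv hC0 ha) (volume_gauge_eq hCv hC0 (ha.trans_le hab)))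
  refine ((continuous_gauge hCv hC0).frontier_preimage_subset _).trans fun x hx => ?_
  rw [frontier_Icc hab] at hx
  exact hx

theorem smul_dir_mem_gaugeShell (hC0 : C ∈ 𝓝 0) (hCc : IsCompact C) {a b r θ : ℝ} (hr : 0 ≤ r) :
    r • dir θ ∈ gaugeShell C a b ↔
      r ∈ Set.Icc (a * (gauge C (dir θ))⁻¹) (b * (gauge C (dir θ))⁻¹) := by
  have h := gauge_dir_pos hC0 hCc θ
  rw [gaugeShell, Set.mem_ofPred_eq, gauge_smul_of_nonneg hr, smul_eq_mul, Set.mem_Icc, Set.mem_Icc,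
    mul_inv_le_iff₀ h, le_mul_inv_iff₀ h]

theorem lintegral_ofReal_Icc {a b : ℝ} (ha : 0 ≤ a) (hab : a ≤ b) :
    ∫⁻ r in Set.Icc a b, ENNReal.ofReal r = ENNReal.ofReal ((b ^ 2 - a ^ 2) / 2) := by
  rw [← ofReal_integral_eq_lintegral_ofReal (f := fun r : ℝ => r) continuous_id.integrableOn_Icc,
    integral_Icc_eq_integral_Ioc, ← intervalIntegral.integral_of_le hab]
  · simp
  · filter_upwards [ae_restrict_mem measurableSet_Icc] with r hr using ha.trans hr.1

/-- The ray of orientation `θ` has length `R = 1 / gauge`, and `∫ r dr` over `[a R, b R]` is `(b² -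
a²) R² / 2`. -/
theorem volume_sector_inter_gaugeShell (hCv : Convex ℝ C) (hC0 : C ∈ 𝓝 0) (hCc : IsCompact C)
    {m h a b : ℝ} (h0 : 0 ≤ h) (hpi : h ≤ Real.pi) (ha : 0 ≤ a) (hab : a ≤ b) :
    volume (sector m h ∩ gaugeShell C a b) = ENNReal.ofReal
      (∫ θ in (m - h)..(m + h), (b ^ 2 - a ^ 2) * (((gauge C (dir θ))⁻¹) ^ 2 / 2)) := by
  have hpos := gauge_dir_pos hC0 hCc
  have hcont : Continuous fun θ => (gauge C (dir θ))⁻¹ :=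
    ((continuous_gauge hCv hC0).comp continuous_dir).inv₀ fun θ => (hpos θ).ne'
  have hnn : 0 ≤ b ^ 2 - a ^ 2 := by nlinarith
  rw [← setLIntegral_one, lintegral_sector h0 hpi (isClosed_gaugeShell hCv hC0 a b).measurableSet
    measurable_const (a := fun θ => a * (gauge C (dir θ))⁻¹)
    (b := fun θ => b * (gauge C (dir θ))⁻¹)
    (fun θ => mul_nonneg ha (inv_nonneg.2 (hpos θ).le))
    (fun θ r hr => smul_dir_mem_gaugeShell hC0 hCc hr.le),
    intervalIntegral.integral_of_le (by linarith), ← integral_Icc_eq_integral_Ioc,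
    ofReal_integral_eq_lintegral_ofReal]
  · refine lintegral_congr fun θ => ?_
    have hi := inv_nonneg.2 (hpos θ).le
    simp only [mul_one]
    rw [lintegral_ofReal_Icc (mul_nonneg ha hi) (mul_le_mul_of_nonneg_right hab hi)]
    congr 1
    ring
  · exact (Continuous.integrableOn_Icc (by fun_prop))
  · exact ae_of_all _ fun θ => by positivity

end Gauge

section Voronoi
variable {K : ℕ} {Y : Fin K → Plane} {Ω : Set Plane}

/-- The `k`-th Voronoi cell translated so that its centre is the origin. -/
def centeredCell (Ω : Set Plane) (Y : Fin K → Plane) (k : Fin K) : Set Plane :=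
  (fun x => Y k + x) ⁻¹' voronoiCell Ω Y k

/-- Hypotheses on the sites and on the region: they make each cell a convex body
around its centre. -/
structure IsConvexVoronoi (Ω : Set Plane) (Y : Fin K → Plane) : Prop where
  injective : Function.Injective Y
  isCompact : IsCompact Ω
  mem_interior : ∀ k, Y k ∈ interior Ω
  convex : ∀ k, Convex ℝ (voronoiCell Ω Y k)

theorem IsConvexVoronoi.isClosed_cell (H : IsConvexVoronoi Ω Y) (k : Fin K) :
    IsClosed (voronoiCell Ω Y k) := by
  have : voronoiCell Ω Y k = Ω ∩ ⋂ j, {X | ‖X - Y k‖ ≤ ‖X - Y j‖} := by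
    ext X
    simp [voronoiCell]
  rw [this]
  exact H.isCompact.isClosed.inter (isClosed_iInter fun j => isClosed_le (by fun_prop) (by fun_prop))

theorem IsConvexVoronoi.isCompact_cell (H : IsConvexVoronoi Ω Y) (k : Fin K) :
    IsCompact (voronoiCell Ω Y k) :=
  H.isCompact.of_isClosed_subset (H.isClosed_cell k) fun _ hX => hX.1

/-- Each site is strictly closer to itself than to the finitely many others, an open condition. -/
theorem IsConvexVoronoi.cell_mem_nhds (H : IsConvexVoronoi Ω Y) (k : Fin K) :
    voronoiCell Ω Y k ∈ 𝓝 (Y k) := by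
  have h1 : ∀ᶠ X in 𝓝 (Y k), ∀ j, ‖X - Y k‖ ≤ ‖X - Y j‖ := by
    rw [eventually_all]
    intro j
    rcases eq_or_ne j k with rfl | hj
    · exact Eventually.of_forall fun _ => le_rfl
    · have hlt : ‖Y k - Y k‖ < ‖Y k - Y j‖ := by
        rw [sub_self, norm_zero, norm_pos_iff, sub_ne_zero]
        exact fun h => hj (H.injective h.symm)
      have := (isOpen_lt (f := fun X => ‖X - Y k‖) (g := fun X => ‖X - Y j‖)
        (by fun_prop) (by fun_prop)).mem_nhds hlt
      filter_upwards [this] with X hX using le_of_lt hX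
  filter_upwards [h1, mem_interior_iff_mem_nhds.1 (H.mem_interior k)] with X h2 h3 using ⟨h3, h2⟩

theorem IsConvexVoronoi.centeredCell_mem_nhds (H : IsConvexVoronoi Ω Y) (k : Fin K) :
    centeredCell Ω Y k ∈ 𝓝 0 := by
  have : Tendsto (fun x => Y k + x) (𝓝 0) (𝓝 (Y k)) := by
    simpa using (continuous_const_add (Y k)).tendsto 0
  exact this (H.cell_mem_nhds k)

theorem IsConvexVoronoi.convex_centeredCell (H : IsConvexVoronoi Ω Y) (k : Fin K) :
    Convex ℝ (centeredCell Ω Y k) :=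
  (H.convex k).translate_preimage_right (Y k)

theorem IsConvexVoronoi.isCompact_centeredCell (H : IsConvexVoronoi Ω Y) (k : Fin K) :
    IsCompact (centeredCell Ω Y k) :=
  (Homeomorph.addLeft (Y k)).isCompact_preimage.2 (H.isCompact_cell k)

/-- By homogeneity of the gauge the admissible radii form the interval `[0, 1 / gauge]`. -/
theorem IsConvexVoronoi.rayLength_eq (H : IsConvexVoronoi Ω Y) (k : Fin K) (θ : ℝ) :
    rayLength Ω Y k θ = (gauge (centeredCell Ω Y k) (dir θ))⁻¹ := by
  have hpos := gauge_dir_pos (H.centeredCell_mem_nhds k) (H.isCompact_centeredCell k) θ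
  have : {r : ℝ | 0 ≤ r ∧ Y k + r • dir θ ∈ voronoiCell Ω Y k} =
      Set.Icc 0 (gauge (centeredCell Ω Y k) (dir θ))⁻¹ := by
    ext r
    refine and_congr_right fun hr => ?_
    change r • dir θ ∈ centeredCell Ω Y k ↔ _
    rw [← gauge_le_one_iff_mem (H.convex_centeredCell k) (H.centeredCell_mem_nhds k)
      (H.isCompact_centeredCell k), gauge_smul_of_nonneg hr, smul_eq_mul, ← le_div_iff₀ hpos,
      one_div]
  rw [rayLength, this, csSup_Icc (inv_nonneg.2 hpos.le)]

theorem IsConvexVoronoi.continuous_rayLength (H : IsConvexVoronoi Ω Y) (k : Fin K) :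
    Continuous (rayLength Ω Y k) := by
  rw [funext (H.rayLength_eq k)]
  exact ((continuous_gauge (H.convex_centeredCell k) (H.centeredCell_mem_nhds k)).comp
    continuous_dir).inv₀ fun θ =>
      (gauge_dir_pos (H.centeredCell_mem_nhds k) (H.isCompact_centeredCell k) θ).ne'

theorem IsConvexVoronoi.voronoiCell_eq (H : IsConvexVoronoi Ω Y) (k : Fin K) :
    voronoiCell Ω Y k = (fun X => X - Y k) ⁻¹' gaugeShell (centeredCell Ω Y k) 0 1 := by
  ext X
  simp only [gaugeShell, Set.mem_preimage, Set.mem_ofPred_eq, Set.mem_Icc, gauge_nonneg, true_and]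
  rw [gauge_le_one_iff_mem (H.convex_centeredCell k) (H.centeredCell_mem_nhds k)
      (H.isCompact_centeredCell k), centeredCell, Set.mem_preimage, add_sub_cancel]

theorem IsConvexVoronoi.shrunkCell_eq (H : IsConvexVoronoi Ω Y) {ε : ℝ} (hε : 0 ≤ ε) (k : Fin K) :
    shrunkCell Ω Y ε k = (fun X => X - Y k) ⁻¹' gaugeShell (centeredCell Ω Y k) ε (1 - ε) := by
  have h0 := H.centeredCell_mem_nhds k
  have hc := H.isCompact_centeredCell k
  ext X
  rw [Set.mem_preimage]
  constructor
  · rintro ⟨θ, -, r, hr, rfl⟩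
    rw [H.rayLength_eq] at hr
    rw [add_sub_cancel_left, smul_dir_mem_gaugeShell h0 hc]
    · exact hr
    · exact (mul_nonneg hε (inv_nonneg.2 (gauge_dir_pos h0 hc θ).le)).trans hr.1
  · intro hX
    obtain ⟨θ, hθ, he⟩ := exists_eq_smul_dir (X - Y k)
    refine ⟨θ, hθ, ‖X - Y k‖, ?_, by rw [← he, add_sub_cancel]⟩
    rw [he, smul_dir_mem_gaugeShell h0 hc (norm_nonneg _)] at hX
    rwa [H.rayLength_eq]

/-- The area of the part of a shell of a Voronoi cell that is seen from its centre
in a sector of orientations. -/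
theorem IsConvexVoronoi.volume_sector_inter_shell (H : IsConvexVoronoi Ω Y) (k : Fin K)
    {m h a b : ℝ} (h0 : 0 ≤ h) (hpi : h ≤ Real.pi) (ha : 0 ≤ a) (hab : a ≤ b) :
    volume ((fun X => X - Y k) ⁻¹' (sector m h ∩ gaugeShell (centeredCell Ω Y k) a b)) =
      ENNReal.ofReal (∫ θ in (m - h)..(m + h), (b ^ 2 - a ^ 2) * (rayLength Ω Y k θ ^ 2 / 2)) := by
  simp only [H.rayLength_eq]
  rw [← volume_sector_inter_gaugeShell (H.convex_centeredCell k) (H.centeredCell_mem_nhds k)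
    (H.isCompact_centeredCell k) h0 hpi ha hab]
  exact (measurePreserving_sub_right volume (Y k)).measure_preimage
    ((isClosed_sector m h).inter (isClosed_gaugeShell (H.convex_centeredCell k)
      (H.centeredCell_mem_nhds k) a b)).measurableSet.nullMeasurableSet

end Voronoi

end Cells

/-! ### The gradient of the distance transform and its orientation density -/

section Orientation

open scoped RealInnerProductSpace ENNReal

section Gradient
variable {K : ℕ} {Y : Fin K → Plane} {Ω : Set Plane}

theorem hasGradientAt_norm_sub {x y : Plane} (h : x ≠ y) :
    HasGradientAt (fun X => ‖X - y‖) (‖x - y‖⁻¹ • (x - y)) x := by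
  -- The norm is differentiated as the square root of the squared norm, away from `0`.
  have hne : ‖x - y‖ ^ 2 ≠ 0 := pow_ne_zero 2 (norm_ne_zero_iff.2 (sub_ne_zero.2 h))
  have h1 := ((hasFDerivAt_id x).sub_const y).norm_sq.sqrt hne
  rw [hasGradientAt_iff_hasFDerivAt]
  refine (h1.congr_fderiv ?_).congr_of_eventuallyEq (Eventually.of_forall fun X => ?_)
  · ext v
    simp [Real.sqrt_sq]
    ring
  · simp [Real.sqrt_sq]

theorem distTransform_eq {k : Fin K} {X : Plane} (h : ∀ j, ‖X - Y k‖ ≤ ‖X - Y j‖) :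
    distTransform Y X = ‖X - Y k‖ :=
  haveI : Nonempty (Fin K) := ⟨k⟩
  le_antisymm (ciInf_le (Set.finite_range _).bddBelow k) (le_ciInf h)

/-- The open set of points whose unique nearest site is `Y k`. -/
def strictCell (Y : Fin K → Plane) (k : Fin K) : Set Plane :=
  {X | ∀ j, j ≠ k → ‖X - Y k‖ < ‖X - Y j‖}

theorem isOpen_strictCell (k : Fin K) : IsOpen (strictCell Y k) := by
  have : strictCell Y k = ⋂ j, {X | j ≠ k → ‖X - Y k‖ < ‖X - Y j‖} := by
    ext X
    simp [strictCell]
  rw [this]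
  refine isOpen_iInter_of_finite fun j => ?_
  by_cases hj : j = k
  · simp [hj]
  · simpa [hj] using isOpen_lt (f := fun X => ‖X - Y k‖) (g := fun X => ‖X - Y j‖)
      (by fun_prop) (by fun_prop)

theorem le_of_mem_strictCell {k : Fin K} {X : Plane} (h : X ∈ strictCell Y k) (j : Fin K) :
    ‖X - Y k‖ ≤ ‖X - Y j‖ := by
  rcases eq_or_ne j k with rfl | hj
  · exact le_rfl
  · exact (h j hj).le

theorem mem_voronoiCell_iff_of_mem_strictCell {k j : Fin K} {X : Plane}
    (h : X ∈ strictCell Y k) : X ∈ voronoiCell Ω Y j ↔ X ∈ Ω ∧ j = k := by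
  constructor
  · intro hj
    refine ⟨hj.1, by_contra fun hne => ?_⟩
    exact (h j hne).not_ge (hj.2 k)
  · rintro ⟨hΩ, rfl⟩
    exact ⟨hΩ, le_of_mem_strictCell h⟩

theorem hasGradientAt_distTransform {k : Fin K} {X : Plane} (h : X ∈ strictCell Y k)
    (hne : X ≠ Y k) : HasGradientAt (distTransform Y) (‖X - Y k‖⁻¹ • (X - Y k)) X := by
  have h1 := hasGradientAt_norm_sub hne
  rw [hasGradientAt_iff_hasFDerivAt] at h1 ⊢
  refine h1.congr_of_eventuallyEq ?_
  filter_upwards [(isOpen_strictCell k).mem_nhds h] with Z hZ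
  exact distTransform_eq (le_of_mem_strictCell hZ)

theorem volume_equidistant {p q : Plane} (h : p ≠ q) :
    volume {X : Plane | ‖X - p‖ = ‖X - q‖} = 0 := by
  have : {X : Plane | ‖X - p‖ = ‖X - q‖} = AffineSubspace.perpBisector p q := by
    ext X
    rw [SetLike.mem_coe, AffineSubspace.mem_perpBisector_iff_dist_eq, dist_eq_norm, dist_eq_norm]
    rfl
  rw [this]
  exact Measure.addHaar_affineSubspace _ _ fun ht => h (AffineSubspace.perpBisector_eq_top.1 ht)

/-- Almost every point has a unique nearest site, from which it is distinct. -/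
theorem ae_exists_mem_strictCell (hK : 1 ≤ K) (hY : Function.Injective Y) :
    ∀ᵐ X : Plane, ∃ k, X ∈ strictCell Y k ∧ X ≠ Y k := by
  have : Nonempty (Fin K) := ⟨⟨0, hK⟩⟩
  have h1 : ∀ᵐ X : Plane, ∀ i j, i ≠ j → ‖X - Y i‖ ≠ ‖X - Y j‖ := by
    rw [ae_all_iff]
    intro i
    rw [ae_all_iff]
    intro j
    by_cases hij : i = j
    · simp [hij]
    · have := measure_eq_zero_iff_ae_notMem.1 (volume_equidistant (fun h => hij (hY h)))
      filter_upwards [this] with X hX _ using hX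
  have h2 : ∀ᵐ X : Plane, ∀ k, X ≠ Y k := by
    rw [ae_all_iff]
    intro k
    exact measure_eq_zero_iff_ae_notMem.1 (measure_singleton (Y k))
  filter_upwards [h1, h2] with X h1 h2
  obtain ⟨k, hk⟩ := Finite.exists_min fun k => ‖X - Y k‖
  exact ⟨k, fun j hj => lt_of_le_of_ne (hk j) (h1 k j hj.symm), h2 k⟩

theorem iUnion_voronoiCell (hK : 1 ≤ K) : ⋃ k, voronoiCell Ω Y k = Ω := by
  have : Nonempty (Fin K) := ⟨⟨0, hK⟩⟩
  refine Set.Subset.antisymm (Set.iUnion_subset fun k X hX => hX.1) fun X hX => ?_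
  obtain ⟨k, hk⟩ := Finite.exists_min fun k => ‖X - Y k‖
  exact Set.mem_iUnion.2 ⟨k, hX, hk⟩

theorem aedisjoint_voronoiCell (hY : Function.Injective Y) {i j : Fin K} (hij : i ≠ j) :
    AEDisjoint volume (voronoiCell Ω Y i) (voronoiCell Ω Y j) :=
  measure_mono_null (fun _ hX => le_antisymm (hX.1.2 j) (hX.2.2 i))
    (volume_equidistant fun h => hij (hY h))

theorem continuous_distTransform (hK : 1 ≤ K) : Continuous (distTransform Y) := by
  have : Nonempty (Fin K) := ⟨⟨0, hK⟩⟩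
  have : distTransform Y = Finset.univ.inf' Finset.univ_nonempty fun k X => ‖X - Y k‖ := by
    ext X
    rw [Finset.inf'_apply, Finset.inf'_univ_eq_ciInf]
    rfl
  rw [this]
  exact Continuous.finset_inf' _ fun k _ => by fun_prop

theorem measurable_gradient (f : Plane → ℝ) : Measurable (gradient f) :=
  (InnerProductSpace.toDual ℝ Plane).symm.continuous.measurable.comp (measurable_fderiv ℝ f)

/-- The union over all sites of the part of the shell `[a, b]` of the cell
seen from the site in a sector of orientations. -/
def sectorShell (Ω : Set Plane) (Y : Fin K → Plane) (m h a b : ℝ) : Set Plane :=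
  ⋃ k, (fun X => X - Y k) ⁻¹' (sector m h ∩ gaugeShell (centeredCell Ω Y k) a b)

theorem IsConvexVoronoi.shell_subset_cell (H : IsConvexVoronoi Ω Y) {a b : ℝ} (ha : 0 ≤ a)
    (hb : b ≤ 1) (k : Fin K) :
    (fun X => X - Y k) ⁻¹' gaugeShell (centeredCell Ω Y k) a b ⊆ voronoiCell Ω Y k := by
  rw [H.voronoiCell_eq]
  exact Set.preimage_mono fun x hx => ⟨ha.trans hx.1, hx.2.trans hb⟩

theorem IsConvexVoronoi.volume_sectorShell (H : IsConvexVoronoi Ω Y) {m h a b : ℝ} (h0 : 0 ≤ h)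
    (hpi : h ≤ Real.pi) (ha : 0 ≤ a) (hab : a ≤ b) (hb : b ≤ 1) :
    volume (sectorShell Ω Y m h a b) = ENNReal.ofReal
      ((b ^ 2 - a ^ 2) * ∫ θ in (m - h)..(m + h), ∑ k, rayLength Ω Y k θ ^ 2 / 2) := by
  have hnn : 0 ≤ b ^ 2 - a ^ 2 := by nlinarith
  have hcell : ∀ k, (fun X => X - Y k) ⁻¹' (sector m h ∩ gaugeShell (centeredCell Ω Y k) a b) ⊆
      voronoiCell Ω Y k := fun k =>
    (Set.preimage_mono Set.inter_subset_right).trans (H.shell_subset_cell ha hb k)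
  rw [sectorShell, measure_iUnion₀, tsum_fintype, intervalIntegral.integral_finsetSum,
    Finset.mul_sum, ENNReal.ofReal_sum_of_nonneg]
  · refine Finset.sum_congr rfl fun k _ => ?_
    rw [H.volume_sector_inter_shell k h0 hpi ha hab, intervalIntegral.integral_const_mul]
  · intro k _
    exact mul_nonneg hnn (intervalIntegral.integral_nonneg (by linarith) fun θ _ => by positivity)
  · intro k _
    have := H.continuous_rayLength k
    exact Continuous.intervalIntegrable (by fun_prop) _ _
  · exact fun i j hij => (aedisjoint_voronoiCell H.injective hij).mono (hcell i) (hcell j)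
  · exact fun k => (((isClosed_sector m h).inter (isClosed_gaugeShell (H.convex_centeredCell k)
      (H.centeredCell_mem_nhds k) a b)).preimage (by fun_prop)).nullMeasurableSet

theorem IsConvexVoronoi.sectorShell_pi_zero_one (H : IsConvexVoronoi Ω Y) (hK : 1 ≤ K) (m : ℝ) :
    sectorShell Ω Y m Real.pi 0 1 = Ω := by
  simp only [sectorShell, sector_pi, Set.univ_inter]
  exact (Set.iUnion_congr fun k => (H.voronoiCell_eq k).symm).trans (iUnion_voronoiCell hK)

theorem IsConvexVoronoi.area_eq (H : IsConvexVoronoi Ω Y) (hK : 1 ≤ K) (m : ℝ) :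
    area Ω = ∫ θ in (m - Real.pi)..(m + Real.pi), ∑ k, rayLength Ω Y k θ ^ 2 / 2 := by
  have h := H.volume_sectorShell (m := m) Real.pi_nonneg le_rfl le_rfl zero_le_one le_rfl
  rw [H.sectorShell_pi_zero_one hK] at h
  rw [area, h, ENNReal.toReal_ofReal]
  · ring
  · refine mul_nonneg (by norm_num) (intervalIntegral.integral_nonneg
      (by linarith [Real.pi_pos]) fun θ _ => by positivity)

theorem IsConvexVoronoi.shrunkRegion_eq (H : IsConvexVoronoi Ω Y) {ε : ℝ} (hε : 0 ≤ ε) (m : ℝ) :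
    shrunkRegion Ω Y ε = sectorShell Ω Y m Real.pi ε (1 - ε) := by
  simp only [sectorShell, sector_pi, Set.univ_inter]
  exact Set.iUnion_congr fun k => H.shrunkCell_eq hε k

/-- The factor is `(1 - ε)² - ε²`. -/
theorem IsConvexVoronoi.area_shrunkRegion (H : IsConvexVoronoi Ω Y) (hK : 1 ≤ K) {ε : ℝ}
    (hε : ε ∈ Set.Ioo (0 : ℝ) (1 / 2)) :
    area (shrunkRegion Ω Y ε) = (1 - 2 * ε) * area Ω := by
  obtain ⟨h0, h1⟩ := hε
  rw [H.shrunkRegion_eq h0.le 0, area, H.volume_sectorShell Real.pi_nonneg le_rfl h0.le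
    (by linarith) (by linarith), ← H.area_eq hK 0, ENNReal.toReal_ofReal]
  · ring
  · exact mul_nonneg (by nlinarith) ENNReal.toReal_nonneg

theorem IsConvexVoronoi.area_pos (H : IsConvexVoronoi Ω Y) (hK : 1 ≤ K) : 0 < area Ω := by
  refine ENNReal.toReal_pos ?_ H.isCompact.measure_lt_top.ne
  exact (Measure.measure_pos_of_nonempty_interior _ ⟨_, H.mem_interior ⟨0, hK⟩⟩).ne'

theorem IsConvexVoronoi.continuous_gradientDensity (H : IsConvexVoronoi Ω Y) :
    Continuous (gradientDensity Ω Y) := by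
  have := H.continuous_rayLength
  unfold gradientDensity
  fun_prop

/-- Up to a null set, the points of the shells at which the gradient of the distance transform
satisfies `p` are those whose direction from the site lies in the sector. -/
theorem IsConvexVoronoi.ae_mem_sectorShell_iff (H : IsConvexVoronoi Ω Y) (hK : 1 ≤ K)
    {m h a b : ℝ} (ha : 0 ≤ a) (hb : b ≤ 1) :
    ∀ᵐ X : Plane, X ∈ sectorShell Ω Y m h a b ↔ X ∈ sectorShell Ω Y m Real.pi a b ∧
      ∃ v, HasGradientAt (distTransform Y) v X ∧ ‖v‖ = 1 ∧ v ∈ sector m h := by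
  filter_upwards [ae_exists_mem_strictCell hK H.injective] with X ⟨k, hk, hne⟩
  have hpos : 0 < ‖X - Y k‖ := norm_pos_iff.2 (sub_ne_zero.2 hne)
  have hg := hasGradientAt_distTransform hk hne
  have hsec : (∃ v, HasGradientAt (distTransform Y) v X ∧ ‖v‖ = 1 ∧ v ∈ sector m h) ↔
      X - Y k ∈ sector m h := by
    rw [← smul_mem_sector (inv_pos.2 hpos)]
    constructor
    · rintro ⟨v, hv, -, hs⟩
      rwa [hg.unique hv]
    · intro hs
      refine ⟨_, hg, ?_, hs⟩
      rw [norm_smul, norm_inv, norm_norm, inv_mul_cancel₀ hpos.ne']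
  -- A point with unique nearest site `Y k` lies in no other cell, so only the `k`-th set of the
  -- union matters.
  have key : ∀ l, X ∈ sectorShell Ω Y m l a b ↔
      X - Y k ∈ sector m l ∧ X - Y k ∈ gaugeShell (centeredCell Ω Y k) a b := by
    intro l
    constructor
    · intro hX
      obtain ⟨j, hj⟩ := Set.mem_iUnion.1 hX
      obtain rfl : j = k := ((mem_voronoiCell_iff_of_mem_strictCell hk).1
        (H.shell_subset_cell ha hb j hj.2)).2
      exact hj
    · exact fun hX => Set.mem_iUnion.2 ⟨k, hX⟩
  rw [hsec, key, key, sector_pi]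
  simp only [Set.mem_univ, true_and]
  exact and_comm

theorem IsConvexVoronoi.orientationProb_eq (H : IsConvexVoronoi Ω Y) (hK : 1 ≤ K) (θ : ℝ) {Δ : ℝ}
    (hΔ : Δ ∈ Set.Ioo 0 (2 * Real.pi)) :
    orientationProb Ω Y θ Δ = ∫ φ in θ..(θ + Δ), gradientDensity Ω Y φ := by
  obtain ⟨h0, h1⟩ := hΔ
  -- The interval `[θ, θ + Δ]` is the sector of half-width `Δ / 2` about its midpoint.
  have hset : {X | X ∈ Ω ∧ ∃ φ ∈ Set.Icc θ (θ + Δ), HasGradientAt (distTransform Y) (dir φ) X}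
      =ᵐ[volume] sectorShell Ω Y (θ + Δ / 2) (Δ / 2) 0 1 := by
    filter_upwards [H.ae_mem_sectorShell_iff hK (m := θ + Δ / 2) (h := Δ / 2) le_rfl le_rfl]
      with X hX
    refine propext (Iff.trans ?_ hX.symm)
    rw [H.sectorShell_pi_zero_one hK]
    refine and_congr_right fun _ => ?_
    constructor
    · rintro ⟨φ, hφ, hg⟩
      refine ⟨_, hg, norm_dir φ, ?_⟩
      rw [mem_sector_iff_exists_dir (by linarith) (by linarith) (norm_dir φ)]
      exact ⟨φ, ⟨by linarith [hφ.1], by linarith [hφ.2]⟩, rfl⟩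
    · rintro ⟨v, hg, hv, hs⟩
      rw [mem_sector_iff_exists_dir (by linarith) (by linarith) hv] at hs
      obtain ⟨φ, hφ, rfl⟩ := hs
      exact ⟨φ, ⟨by linarith [hφ.1], by linarith [hφ.2]⟩, hg⟩
  rw [orientationProb, area, area, measure_congr hset, H.volume_sectorShell (by linarith)
    (by linarith) le_rfl zero_le_one le_rfl, ENNReal.toReal_ofReal]
  · simp only [gradientDensity]
    rw [intervalIntegral.integral_const_mul, area]
    ring_nf
  · exact mul_nonneg (by norm_num) (intervalIntegral.integral_nonneg (by linarith)
      fun θ _ => by positivity)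

theorem tendsto_average_of_continuous {g : ℝ → ℝ} (hg : Continuous g) (x : ℝ) :
    Tendsto (fun Δ : ℝ => (∫ φ in x..(x + Δ), g φ) / Δ) (𝓝[>] 0) (𝓝 (g x)) := by
  have h := (intervalIntegral.integral_hasDerivAt_right (hg.intervalIntegrable x x)
    (hg.stronglyMeasurableAtFilter _ _) hg.continuousAt).tendsto_slope_zero_right
  refine h.congr fun Δ => ?_
  rw [intervalIntegral.integral_same, sub_zero, smul_eq_mul, div_eq_inv_mul]

end Gradient

end Orientation

/-! ### Weak convergence of the power spectrum to the law of the gradient -/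

section WeakLimit
open FourierTransform
open scoped RealInnerProductSpace ComplexConjugate ENNReal

variable {E : Set Plane} {S : Plane → ℝ}

/-- The wave `exp (i S / τ)` cut off outside `E`. -/
def cutoffWave (E : Set Plane) (S : Plane → ℝ) (τ : ℝ) : Plane → ℂ :=
  E.indicator fun X => Complex.exp (Complex.I * ((S X / τ : ℝ) : ℂ))

/-- The density of the power spectrum of the cut-off wave. -/
def wavePower (E : Set Plane) (S : Plane → ℝ) (τ : ℝ) (u : Plane) : ℝ :=
  (area E)⁻¹ * ((2 * Real.pi * τ)⁻¹ ^ 2 * ‖𝓕 (cutoffWave E S τ) ((2 * Real.pi * τ)⁻¹ • u)‖ ^ 2)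

theorem norm_exp_I_mul_ofReal (x : ℝ) : ‖Complex.exp (Complex.I * (x : ℂ))‖ = 1 := by
  rw [mul_comm, Complex.norm_exp_ofReal_mul_I]

theorem norm_cutoffWave_le (τ : ℝ) (X : Plane) :
    ‖cutoffWave E S τ X‖ ≤ E.indicator (fun _ => (1 : ℝ)) X := by
  by_cases hX : X ∈ E
  · simp only [cutoffWave, Set.indicator_of_mem hX, norm_exp_I_mul_ofReal, le_refl]
  · simp [cutoffWave, Set.indicator_of_notMem hX]

theorem measurable_cutoffWave (hE : MeasurableSet E) (hS : Continuous S) (τ : ℝ) :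
    Measurable (cutoffWave E S τ) :=
  Measurable.indicator (Continuous.measurable (by fun_prop)) hE

theorem memLp_cutoffWave (hE : MeasurableSet E) (hEf : volume E ≠ ∞) (hS : Continuous S) (τ : ℝ)
    (p : ℝ≥0∞) : MemLp (cutoffWave E S τ) p :=
  (memLp_indicator_const p hE (1 : ℝ) (Or.inr hEf)).of_le
    (measurable_cutoffWave hE hS τ).aestronglyMeasurable
    (ae_of_all _ fun X => (norm_cutoffWave_le τ X).trans (le_abs_self _))

theorem integrable_cutoffWave (hE : MeasurableSet E) (hEf : volume E ≠ ∞) (hS : Continuous S)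
    (τ : ℝ) : Integrable (cutoffWave E S τ) :=
  memLp_one_iff_integrable.1 (memLp_cutoffWave hE hEf hS τ 1)

theorem wavePower_nonneg (τ : ℝ) (u : Plane) : 0 ≤ wavePower E S τ u := by
  have : 0 ≤ area E := ENNReal.toReal_nonneg
  unfold wavePower
  positivity

theorem continuous_wavePower (hE : MeasurableSet E) (hEf : volume E ≠ ∞) (hS : Continuous S)
    (τ : ℝ) : Continuous (wavePower E S τ) := by
  have := continuous_fourier_of_integrable (integrable_cutoffWave hE hEf hS τ)
  unfold wavePower
  fun_prop

theorem integrable_wavePower (hE : MeasurableSet E) (hEf : volume E ≠ ∞) (hS : Continuous S)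
    {τ : ℝ} (hτ : 0 < τ) : Integrable (wavePower E S τ) := by
  have hne : (2 * Real.pi * τ)⁻¹ ≠ 0 := by positivity
  exact (((integrable_norm_sq_fourier (integrable_cutoffWave hE hEf hS τ)
    (memLp_cutoffWave hE hEf hS τ 2)).comp_smul hne).const_mul _).const_mul _

/-- The measure whose density is the power spectrum. -/
def spectralMeasure (E : Set Plane) (S : Plane → ℝ) (τ : ℝ) : Measure Plane :=
  volume.withDensity fun u => ENNReal.ofReal (wavePower E S τ u)

theorem charFun_spectralMeasure (hE : MeasurableSet E) (hEf : volume E ≠ ∞) (hS : Continuous S)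
    {τ : ℝ} (hτ : 0 < τ) (t : Plane) :
    charFun (spectralMeasure E S τ) t = ((area E)⁻¹ : ℝ) *
      ∫ X, conj (cutoffWave E S τ X) * cutoffWave E S τ (X + τ • t) := by
  have hpos : 0 < 2 * Real.pi * τ := by positivity
  rw [charFun_apply, spectralMeasure, integral_withDensity_eq_integral_toReal_smul
    (continuous_wavePower hE hEf hS τ).measurable.ennreal_ofReal
    (ae_of_all _ fun _ => ENNReal.ofReal_lt_top),
    ← integral_norm_sq_fourier_mul_exp (integrable_cutoffWave hE hEf hS τ)
      (memLp_cutoffWave hE hEf hS τ 2)]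
  -- Substituting `w = u / (2πτ)` in dimension two produces the Jacobian `(2πτ)⁻²`, which is the
  -- normalisation in `wavePower`.
  set g : Plane → ℂ := fun w => ((‖𝓕 (cutoffWave E S τ) w‖ ^ 2 : ℝ) : ℂ) *
    Complex.exp (2 * Real.pi * ⟪τ • t, w⟫ * Complex.I)
  have h := Measure.integral_comp_smul volume g (2 * Real.pi * τ)⁻¹
  rw [finrank_euclideanSpace_fin, inv_pow, inv_inv, abs_of_pos (by positivity)] at h
  have h2 : ∫ w, g w = ((2 * Real.pi * τ)⁻¹ ^ 2 : ℝ) • ∫ x, g ((2 * Real.pi * τ)⁻¹ • x) := by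
    rw [h, smul_smul, ← mul_pow, inv_mul_cancel₀ hpos.ne', one_pow, one_smul]
  rw [h2, Complex.real_smul, ← integral_const_mul, ← integral_const_mul]
  refine integral_congr_ae (ae_of_all _ fun u => ?_)
  have he : 2 * Real.pi * ⟪τ • t, (2 * Real.pi * τ)⁻¹ • u⟫ = ⟪u, t⟫ := by
    rw [real_inner_smul_left, real_inner_smul_right, real_inner_comm]
    field_simp
  simp only [g]
  rw [ENNReal.toReal_ofReal (wavePower_nonneg τ u), Complex.real_smul, wavePower, ← he]
  push_cast
  ring

theorem isProbabilityMeasure_spectralMeasure (hE : MeasurableSet E) (hEf : volume E ≠ ∞)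
    (hE0 : volume E ≠ 0) (hS : Continuous S) {τ : ℝ} (hτ : 0 < τ) :
    IsProbabilityMeasure (spectralMeasure E S τ) := by
  have : IsFiniteMeasure (spectralMeasure E S τ) :=
    isFiniteMeasure_withDensity_ofReal (integrable_wavePower hE hEf hS hτ).2
  have h := charFun_spectralMeasure hE hEf hS hτ 0
  have h1 : ∀ X, conj (cutoffWave E S τ X) * cutoffWave E S τ X =
      E.indicator (fun _ => (1 : ℂ)) X := by
    intro X
    by_cases hX : X ∈ E
    · rw [Complex.conj_mul', cutoffWave, Set.indicator_of_mem hX, Set.indicator_of_mem hX,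
        norm_exp_I_mul_ofReal]
      simp
    · simp [cutoffWave, Set.indicator_of_notMem hX]
  have ha : area E ≠ 0 := ENNReal.toReal_ne_zero.2 ⟨hE0, hEf⟩
  simp only [charFun_zero, smul_zero, add_zero, h1] at h
  rw [integral_indicator hE, setIntegral_const, Complex.real_smul, mul_one,
    show volume.real E = area E from rfl, ← Complex.ofReal_mul, inv_mul_cancel₀ ha, Complex.ofReal_inj] at h
  refine ⟨?_⟩
  rw [← ENNReal.toReal_eq_one_iff]
  exact h

/-- The law of `N` at a uniformly distributed point of `E`. -/
def gradientLaw (E : Set Plane) (N : Plane → Plane) : Measure Plane :=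
  ((volume E)⁻¹ • volume.restrict E).map N

theorem isProbabilityMeasure_gradientLaw (hEf : volume E ≠ ∞) (hE0 : volume E ≠ 0)
    {N : Plane → Plane} (hN : Measurable N) : IsProbabilityMeasure (gradientLaw E N) := by
  have : IsProbabilityMeasure ((volume E)⁻¹ • volume.restrict E) :=
    ⟨by simp [ENNReal.inv_mul_cancel hE0 hEf]⟩
  exact Measure.isProbabilityMeasure_map hN.aemeasurable

theorem charFun_gradientLaw {N : Plane → Plane} (hN : Measurable N) (t : Plane) :
    charFun (gradientLaw E N) t = ((area E)⁻¹ : ℝ) *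
      ∫ X in E, Complex.exp (⟪N X, t⟫ * Complex.I) := by
  rw [charFun_apply, gradientLaw, integral_map hN.aemeasurable
    (Continuous.aestronglyMeasurable (by fun_prop)), integral_smul_measure, Complex.real_smul,
    ENNReal.toReal_inv, area]

/-- The autocorrelation of the wave converges to the characteristic function of its gradient. -/
theorem tendsto_autocorrelation_cutoffWave (hE : MeasurableSet E) (hEb : Bornology.IsBounded E)
    (hEfr : volume (frontier E) = 0) (hS : Continuous S) {N : Plane → Plane}
    (hgrad : ∀ᵐ X, X ∈ E → HasGradientAt S (N X) X) {s : ℕ → ℝ}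
    (hs : Tendsto s atTop (𝓝[>] 0)) (t : Plane) :
    Tendsto (fun n => ∫ X, conj (cutoffWave E S (s n) X) * cutoffWave E S (s n) (X + s n • t))
      atTop (𝓝 (∫ X in E, Complex.exp (⟪N X, t⟫ * Complex.I))) := by
  have hEf : volume E ≠ ∞ := hEb.measure_lt_top.ne
  rw [← integral_indicator hE]
  refine tendsto_integral_of_dominated_convergence (E.indicator fun _ => (1 : ℝ)) ?_
    ((integrable_indicator_iff hE).2 (integrableOn_const hEf)) ?_ ?_
  · intro n
    have hm := measurable_cutoffWave hE hS (s n)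
    exact (((Complex.continuous_conj.measurable.comp hm).mul
      (hm.comp (measurable_add_const _)))).aestronglyMeasurable
  · intro n
    refine ae_of_all _ fun X => ?_
    rw [norm_mul, RCLike.norm_conj]
    have h1 := norm_cutoffWave_le (E := E) (S := S) (s n) X
    have h2 : ‖cutoffWave E S (s n) (X + s n • t)‖ ≤ 1 :=
      (norm_cutoffWave_le _ _).trans (Set.indicator_le_self' (fun _ _ => zero_le_one) _)
    exact (mul_le_of_le_one_right (norm_nonneg _) h2).trans h1
  · filter_upwards [hgrad, measure_eq_zero_iff_ae_notMem.1 hEfr] with X hX hfr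
    by_cases hXE : X ∈ E
    swap
    · simp [cutoffWave, Set.indicator_of_notMem hXE]
    rw [Set.indicator_of_mem hXE]
    -- Interiority keeps `X + s n • t` in `E` eventually, so the cutoff does not disturb the
    -- pointwise limit.
    have hint : X ∈ interior E := by
      by_contra hni
      exact hfr ⟨subset_closure hXE, hni⟩
    have hd : HasDerivAt (fun r : ℝ => S (X + r • t)) ⟪N X, t⟫ 0 := by
      have h1 : HasFDerivAt S (InnerProductSpace.toDual ℝ Plane (N X)) (X + (0 : ℝ) • t) := by
        simpa using (hX hXE).hasFDerivAt
      have h2 : HasDerivAt (fun r : ℝ => X + r • t) t 0 := by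
        simpa using ((hasDerivAt_id (0 : ℝ)).smul_const t).const_add X
      exact h1.comp_hasDerivAt 0 h2
    have hlim := (hd.tendsto_slope_zero_right).comp hs
    have hmem : ∀ᶠ n in atTop, X + s n • t ∈ E := by
      have hc : Tendsto (fun n => X + s n • t) atTop (𝓝 X) := by
        have := ((tendsto_nhds_of_tendsto_nhdsWithin hs).smul_const t).const_add X
        simpa using this
      exact hc (mem_interior_iff_mem_nhds.1 hint)
    have hexp := (Complex.continuous_exp.tendsto _).comp
      ((Complex.continuous_ofReal.tendsto _).comp hlim |>.mul_const Complex.I)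
    refine hexp.congr' ?_
    filter_upwards [hmem] with n hn
    simp only [Function.comp_apply, cutoffWave, Set.indicator_of_mem hXE, Set.indicator_of_mem hn,
      zero_add, zero_smul, add_zero, smul_eq_mul]
    rw [← Complex.exp_conj, ← Complex.exp_add]
    congr 1
    rw [map_mul, Complex.conj_I, Complex.conj_ofReal]
    push_cast
    ring

/-- The power spectrum of a wave converges weakly to the law of the gradient of its phase. -/
theorem tendsto_setIntegral_wavePower (hE : MeasurableSet E) (hEb : Bornology.IsBounded E)
    (hE0 : volume E ≠ 0) (hEfr : volume (frontier E) = 0) (hS : Continuous S)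
    {N : Plane → Plane} (hN : Measurable N) (hgrad : ∀ᵐ X, X ∈ E → HasGradientAt S (N X) X)
    {A : Set Plane} (hA : MeasurableSet A) (hAfr : ∀ᵐ X, X ∈ E → N X ∉ frontier A) :
    Tendsto (fun τ => (∫⁻ u in A, ENNReal.ofReal (wavePower E S τ u)).toReal) (𝓝[>] 0)
      (𝓝 ((area E)⁻¹ * area (E ∩ N ⁻¹' A))) := by
  have hEf : volume E ≠ ∞ := hEb.measure_lt_top.ne
  have hlaw : ∀ B, MeasurableSet B →
      gradientLaw E N B = (volume E)⁻¹ * volume (E ∩ N ⁻¹' B) := by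
    intro B hB
    rw [gradientLaw, Measure.map_apply hN hB, Measure.smul_apply, Measure.restrict_apply (hN hB),
      smul_eq_mul, Set.inter_comm]
  have hP := isProbabilityMeasure_gradientLaw hEf hE0 hN
  have hnull : gradientLaw E N (frontier A) = 0 := by
    rw [hlaw _ isClosed_frontier.measurableSet]
    refine mul_eq_zero_of_right _ (measure_eq_zero_iff_ae_notMem.2 ?_)
    filter_upwards [hAfr] with X hX hmem using hX hmem.1 hmem.2
  -- Work along sequences `τ = s n`, dropping the initial terms that may fail to be positive, for
  -- which `spectralMeasure` need not be a probability measure.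
  refine tendsto_of_seq_tendsto fun s hs => ?_
  obtain ⟨n₀, hn₀⟩ := eventually_atTop.1 (hs.eventually self_mem_nhdsWithin)
  have hpos : ∀ n, 0 < s (n + n₀) := fun n => hn₀ _ (Nat.le_add_left _ _)
  have hs' : Tendsto (fun n => s (n + n₀)) atTop (𝓝[>] 0) := hs.comp (tendsto_add_atTop_nat n₀)
  rw [← tendsto_add_atTop_iff_nat n₀]
  let μ : ℕ → ProbabilityMeasure Plane := fun n =>
    ⟨spectralMeasure E S (s (n + n₀)),
      isProbabilityMeasure_spectralMeasure hE hEf hE0 hS (hpos n)⟩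
  have hμ : Tendsto μ atTop (𝓝 ⟨gradientLaw E N, hP⟩) := by
    refine ProbabilityMeasure.tendsto_iff_tendsto_charFun.2 fun t => ?_
    have h1 : charFun (gradientLaw E N) t = _ := charFun_gradientLaw hN t
    simp only [μ, ProbabilityMeasure.coe_mk, h1]
    refine ((tendsto_autocorrelation_cutoffWave hE hEb hEfr hS hgrad hs' t).const_mul _).congr
      fun n => ?_
    exact (charFun_spectralMeasure hE hEf hS (hpos n) t).symm
  have hport := ProbabilityMeasure.tendsto_measure_of_null_frontier_of_tendsto' hμ (E := A) hnull
  have hfin := (ENNReal.tendsto_toReal (measure_ne_top (gradientLaw E N) A)).comp hport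
  convert hfin using 2
  · simp only [Function.comp_apply, μ, ProbabilityMeasure.coe_mk]
    rw [spectralMeasure, withDensity_apply _ hA]
  · rw [hlaw A hA, ENNReal.toReal_mul, ENNReal.toReal_inv, area, area]

end WeakLimit

/-! ### The annular sector and the final limits -/

section Main
open FourierTransform
open scoped RealInnerProductSpace ENNReal

variable {K : ℕ} {Y : Fin K → Plane} {Ω : Set Plane}

theorem powerSpectrum_eq_wavePower {ε τ : ℝ} (hE : MeasurableSet (shrunkRegion Ω Y ε))
    (r ω : ℝ) :
    powerSpectrum Ω Y ε τ r ω =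
      wavePower (shrunkRegion Ω Y ε) (distTransform Y) τ (r • dir ω) := by
  have hF : ∫ X in shrunkRegion Ω Y ε, Complex.exp (Complex.I * ((distTransform Y X / τ : ℝ) : ℂ)) *
        Complex.exp (-Complex.I * (((r * Real.cos ω * X 0 + r * Real.sin ω * X 1) / τ : ℝ) : ℂ)) =
      𝓕 (cutoffWave (shrunkRegion Ω Y ε) (distTransform Y) τ)
        ((2 * Real.pi * τ)⁻¹ • r • dir ω) := by
    rw [Real.fourier_eq', ← integral_indicator hE]
    refine integral_congr_ae (ae_of_all _ fun X => ?_)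
    by_cases hX : X ∈ shrunkRegion Ω Y ε
    · simp only [cutoffWave, Set.indicator_of_mem hX, smul_eq_mul]
      rw [mul_comm]
      congr 2
      have : ⟪X, (2 * Real.pi * τ)⁻¹ • r • dir ω⟫ =
          (2 * Real.pi * τ)⁻¹ * (r * Real.cos ω * X 0 + r * Real.sin ω * X 1) := by
        have h3 : ⟪X, dir ω⟫ = Real.cos ω * X 0 + Real.sin ω * X 1 := by
          simp [dir, PiLp.inner_apply, Fin.sum_univ_two]
        rw [real_inner_smul_right, real_inner_smul_right, h3]
        ring
      have h2 : -2 * Real.pi * ((2 * Real.pi * τ)⁻¹ *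
          (r * Real.cos ω * X 0 + r * Real.sin ω * X 1)) =
          -((r * Real.cos ω * X 0 + r * Real.sin ω * X 1) / τ) := by
        -- At `τ = 0` both sides vanish because division by zero gives `0`.
        rcases eq_or_ne τ 0 with rfl | hτ
        · simp
        · have := Real.pi_ne_zero
          field_simp
      rw [this, h2]
      push_cast
      ring
    · simp [cutoffWave, Set.indicator_of_notMem hX]
  rw [powerSpectrum, waveFourier, hF, norm_mul, mul_pow, wavePower, Complex.norm_real,
    Real.norm_eq_abs, sq_abs, one_div, mul_inv, mul_pow, inv_pow (Real.sqrt _),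
    Real.sq_sqrt (show 0 ≤ area (shrunkRegion Ω Y ε) from ENNReal.toReal_nonneg)]
  ring

theorem IsConvexVoronoi.isClosed_shrunkRegion (H : IsConvexVoronoi Ω Y) {ε : ℝ} (hε : 0 ≤ ε) :
    IsClosed (shrunkRegion Ω Y ε) := by
  refine isClosed_iUnion_of_finite fun k => ?_
  rw [H.shrunkCell_eq hε]
  exact (isClosed_gaugeShell (H.convex_centeredCell k)
    (H.centeredCell_mem_nhds k) _ _).preimage (by fun_prop)

theorem IsConvexVoronoi.isBounded_shrunkRegion (H : IsConvexVoronoi Ω Y) {ε : ℝ} (hε : 0 ≤ ε) :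
    Bornology.IsBounded (shrunkRegion Ω Y ε) := by
  refine H.isCompact.isBounded.subset (Set.iUnion_subset fun k => ?_)
  rw [H.shrunkCell_eq hε]
  exact (H.shell_subset_cell hε (by linarith) k).trans fun _ hX => hX.1

theorem frontier_iUnion_subset_of_finite {X ι : Type*} [TopologicalSpace X] [Finite ι]
    (s : ι → Set X) : frontier (⋃ i, s i) ⊆ ⋃ i, frontier (s i) := by
  rintro x ⟨hc, hi⟩
  rw [closure_iUnion_of_finite] at hc
  obtain ⟨i, hci⟩ := Set.mem_iUnion.1 hc
  exact Set.mem_iUnion.2 ⟨i, hci, fun h => hi (interior_mono (Set.subset_iUnion s i) h)⟩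

theorem IsConvexVoronoi.volume_frontier_shrunkRegion (H : IsConvexVoronoi Ω Y) {ε : ℝ}
    (hε : ε ∈ Set.Ioo (0 : ℝ) (1 / 2)) : volume (frontier (shrunkRegion Ω Y ε)) = 0 := by
  obtain ⟨h0, h1⟩ := hε
  refine measure_mono_null (frontier_iUnion_subset_of_finite _) (measure_iUnion_null fun k => ?_)
  rw [H.shrunkCell_eq h0.le, show (fun X => X - Y k) = Homeomorph.subRight (Y k) from rfl,
    ← Homeomorph.preimage_frontier]
  exact (measurePreserving_sub_right volume (Y k)).quasiMeasurePreserving.preimage_null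
    (volume_frontier_gaugeShell (H.convex_centeredCell k) (H.centeredCell_mem_nhds k) h0
      (by linarith))

theorem ae_hasGradientAt_gradient (hK : 1 ≤ K) (hY : Function.Injective Y) :
    ∀ᵐ X : Plane, HasGradientAt (distTransform Y) (gradient (distTransform Y) X) X ∧
      ‖gradient (distTransform Y) X‖ = 1 := by
  filter_upwards [ae_exists_mem_strictCell hK hY] with X ⟨k, hk, hne⟩
  have hg := hasGradientAt_distTransform hk hne
  rw [hg.gradient]
  refine ⟨hg, ?_⟩
  rw [norm_smul, norm_inv, norm_norm, inv_mul_cancel₀ (norm_ne_zero_iff.2 (sub_ne_zero.2 hne))]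

theorem volume_line (c : ℝ) : volume (Submodule.span ℝ {dir c} : Set Plane) = 0 := by
  refine Measure.addHaar_submodule _ _ fun h => ?_
  have hm : dir (c + Real.pi / 2) ∈ Submodule.span ℝ {dir c} := h ▸ Submodule.mem_top
  obtain ⟨a, ha⟩ := Submodule.mem_span_singleton.1 hm
  have h1 := inner_dir_dir (c + Real.pi / 2) (c + Real.pi / 2)
  have h2 := inner_dir_dir c (c + Real.pi / 2)
  nth_rewrite 1 [← ha] at h1
  rw [real_inner_smul_left, h2] at h1
  simp at h1

/-- A gradient equal to `dir c` puts `X` on the line through its nearest site with orientation `c`;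
these finitely many lines are null. -/
theorem ae_gradient_ne_dir (hK : 1 ≤ K) (hY : Function.Injective Y) (c : ℝ) :
    ∀ᵐ X : Plane, gradient (distTransform Y) X ≠ dir c := by
  have h : ∀ᵐ X : Plane, ∀ k, X - Y k ∉ (Submodule.span ℝ {dir c} : Set Plane) := by
    rw [ae_all_iff]
    intro k
    exact measure_eq_zero_iff_ae_notMem.1 ((measurePreserving_sub_right volume
      (Y k)).quasiMeasurePreserving.preimage_null (volume_line c))
  filter_upwards [h, ae_exists_mem_strictCell hK hY] with X hX ⟨k, hk, hne⟩ heq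
  rw [(hasGradientAt_distTransform hk hne).gradient] at heq
  refine hX k (Submodule.mem_span_singleton.2 ⟨‖X - Y k‖, ?_⟩)
  rw [← heq, smul_smul, mul_inv_cancel₀ (norm_ne_zero_iff.2 (sub_ne_zero.2 hne)), one_smul]

/-- The annular sector over which the power spectrum is integrated. -/
def annularSector (m h δ : ℝ) : Set Plane :=
  sector m h ∩ {x | ‖x‖ ∈ Set.Icc (1 - δ) (1 + δ)}

theorem isClosed_annulus (δ : ℝ) : IsClosed {x : Plane | ‖x‖ ∈ Set.Icc (1 - δ) (1 + δ)} :=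
  isClosed_Icc.preimage continuous_norm

theorem eq_or_eq_of_mem_frontier_annularSector {m h δ : ℝ} (h0 : 0 ≤ h) (hpi : h ≤ Real.pi)
    (hδ : 0 < δ) {v : Plane} (hv : ‖v‖ = 1) (hfr : v ∈ frontier (annularSector m h δ)) :
    v = dir (m - h) ∨ v = dir (m + h) := by
  -- On the unit circle the frontier can only come from the sector, as `1` lies strictly between the
  -- radii `1 - δ` and `1 + δ`.
  have hcos : Real.cos h = ⟪v, dir m⟫ := by
    rcases frontier_inter_subset _ _ hfr with hs | hs
    · have := frontier_le_subset_eq (f := fun x : Plane => Real.cos h * ‖x‖)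
        (g := fun x => ⟪x, dir m⟫) (by fun_prop) (by fun_prop) hs.1
      simpa [hv] using this
    · have := continuous_norm.frontier_preimage_subset (Set.Icc (1 - δ) (1 + δ)) hs.2
      rw [Set.mem_preimage, frontier_Icc (by linarith), hv] at this
      rcases this with h | h
      · linarith
      · have : 1 = 1 + δ := h
        linarith
  obtain ⟨θ, hθ, rfl⟩ := exists_dir_eq m hv
  rw [inner_dir_dir, ← Real.cos_abs (θ - m)] at hcos
  have := Real.injOn_cos ⟨h0, hpi⟩ ⟨abs_nonneg _, hθ⟩ hcos
  rcases abs_choice (θ - m) with ha | ha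
  · right
    congr 1
    linarith
  · left
    congr 1
    linarith

/-- The integral of the power spectrum over an annular sector as an iterated integral. -/
theorem toReal_lintegral_annularSector {m h δ : ℝ} (h0 : 0 ≤ h) (hpi : h ≤ Real.pi) (hδ0 : 0 < δ)
    (hδ1 : δ < 1) {f : Plane → ℝ} (hf : Continuous f) (hf0 : ∀ x, 0 ≤ f x) :
    (∫⁻ u in annularSector m h δ, ENNReal.ofReal (f u)).toReal =
      ∫ ω in (m - h)..(m + h), ∫ r in (1 - δ)..(1 + δ), f (r • dir ω) * r := by
  have hc : Continuous fun p : ℝ × ℝ => f (p.2 • dir p.1) * p.2 :=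
    (hf.comp (continuous_snd.smul (continuous_dir.comp continuous_fst))).mul continuous_snd
  have hin : ∀ ω, 0 ≤ ∫ r in (1 - δ)..(1 + δ), f (r • dir ω) * r := fun ω =>
    intervalIntegral.integral_nonneg (by linarith) fun r hr =>
      mul_nonneg (hf0 _) (by linarith [hr.1])
  rw [annularSector, lintegral_sector h0 hpi (isClosed_annulus δ).measurableSet
    hf.measurable.ennreal_ofReal (a := fun _ => 1 - δ) (b := fun _ => 1 + δ)
    (fun _ => by linarith) (fun θ r hr => by
      rw [Set.mem_ofPred_eq, norm_smul, norm_dir, mul_one, Real.norm_of_nonneg hr.le])]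
  have hinner : ∀ ω, ∫⁻ r in Set.Icc (1 - δ) (1 + δ),
      ENNReal.ofReal r * ENNReal.ofReal (f (r • dir ω)) =
      ENNReal.ofReal (∫ r in (1 - δ)..(1 + δ), f (r • dir ω) * r) := by
    intro ω
    rw [intervalIntegral.integral_of_le (by linarith), ← integral_Icc_eq_integral_Ioc,
      ofReal_integral_eq_lintegral_ofReal]
    · refine setLIntegral_congr_fun measurableSet_Icc fun r hr => ?_
      rw [mul_comm, ← ENNReal.ofReal_mul (hf0 _)]
    · exact (hc.comp (Continuous.prodMk_right ω)).integrableOn_Icc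
    · filter_upwards [ae_restrict_mem measurableSet_Icc] with r hr
      exact mul_nonneg (hf0 _) (by linarith [hr.1])
  simp only [hinner]
  rw [intervalIntegral.integral_of_le (by linarith), ← integral_Icc_eq_integral_Ioc,
    integral_eq_lintegral_of_nonneg_ae (ae_of_all _ hin)]
  exact (intervalIntegral.continuous_parametric_intervalIntegral_of_continuous' hc
    _ _).aestronglyMeasurable

/-- The power spectrum in an annular sector converges to the gradient orientation distribution. -/
theorem IsConvexVoronoi.tendsto_integral_powerSpectrum (H : IsConvexVoronoi Ω Y) (hK : 1 ≤ K)
    {δ : ℝ} (hδ0 : 0 < δ) (hδ1 : δ < 1) (ω₀ : ℝ) {ε Δ : ℝ} (hε : ε ∈ Set.Ioo (0 : ℝ) (1 / 2))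
    (hΔ : Δ ∈ Set.Ioo (0 : ℝ) (2 * Real.pi)) :
    Tendsto (fun τ : ℝ => ∫ ω in ω₀..(ω₀ + Δ), ∫ r in (1 - δ)..(1 + δ),
        powerSpectrum Ω Y ε τ r ω * r)
      (𝓝[>] 0) (𝓝 (∫ φ in ω₀..(ω₀ + Δ), gradientDensity Ω Y φ)) := by
  set m := ω₀ + Δ / 2 with hm
  have hh0 : 0 ≤ Δ / 2 := by linarith [hΔ.1]
  have hhpi : Δ / 2 ≤ Real.pi := by linarith [hΔ.2]
  have hm1 : m - Δ / 2 = ω₀ := by rw [hm]; ring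
  have hm2 : m + Δ / 2 = ω₀ + Δ := by rw [hm]; ring
  have hEm := (H.isClosed_shrunkRegion hε.1.le).measurableSet
  have hEb := H.isBounded_shrunkRegion hε.1.le
  have hL := H.area_pos hK
  have hLε := H.area_shrunkRegion hK hε
  have h2ε : 0 < 1 - 2 * ε := by linarith [hε.2]
  have hE0 : volume (shrunkRegion Ω Y ε) ≠ 0 := fun h => by
    have : 0 < area (shrunkRegion Ω Y ε) := hLε ▸ mul_pos h2ε hL
    simp [area, h] at this
  have hS : Continuous (distTransform Y) := continuous_distTransform hK
  have hgrad := ae_hasGradientAt_gradient hK H.injective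
  have key := tendsto_setIntegral_wavePower hEm hEb hE0 (H.volume_frontier_shrunkRegion hε) hS
    (measurable_gradient (distTransform Y)) (hgrad.mono fun X hX _ => hX.1)
    (A := annularSector m (Δ / 2) δ)
    ((isClosed_sector _ _).inter (isClosed_annulus δ)).measurableSet (by
      filter_upwards [hgrad, ae_gradient_ne_dir hK H.injective (m - Δ / 2),
        ae_gradient_ne_dir hK H.injective (m + Δ / 2)] with X h1 h2 h3 _ h4
      exact (eq_or_eq_of_mem_frontier_annularSector hh0 hhpi hδ0 h1.2 h4).elim h2 h3)
  have hset : (shrunkRegion Ω Y ε ∩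
      gradient (distTransform Y) ⁻¹' annularSector m (Δ / 2) δ : Set Plane) =ᵐ[volume]
      sectorShell Ω Y m (Δ / 2) ε (1 - ε) := by
    filter_upwards [hgrad, H.ae_mem_sectorShell_iff hK (m := m) (h := Δ / 2) hε.1.le
      (show 1 - ε ≤ 1 by linarith [hε.1])] with X hX1 hX2
    refine propext (Iff.trans ?_ hX2.symm)
    rw [← H.shrunkRegion_eq hε.1.le m]
    refine and_congr_right fun _ => ?_
    constructor
    · exact fun hX => ⟨_, hX1.1, hX1.2, hX.1⟩
    · rintro ⟨v, hv, h1, hs⟩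
      refine ⟨hv.gradient ▸ hs, ?_⟩
      rw [Set.mem_ofPred_eq, hX1.2]
      constructor <;> linarith
  have hlim : (area (shrunkRegion Ω Y ε))⁻¹ * area (shrunkRegion Ω Y ε ∩
      gradient (distTransform Y) ⁻¹' annularSector m (Δ / 2) δ) =
      ∫ φ in ω₀..(ω₀ + Δ), gradientDensity Ω Y φ := by
    have hnn : 0 ≤ ∫ θ in ω₀..(ω₀ + Δ), ∑ k, rayLength Ω Y k θ ^ 2 / 2 :=
      intervalIntegral.integral_nonneg (by linarith [hΔ.1]) fun θ _ => by positivity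
    have hr : (1 - ε) ^ 2 - ε ^ 2 = 1 - 2 * ε := by ring
    have hv : area (sectorShell Ω Y m (Δ / 2) ε (1 - ε)) =
        (1 - 2 * ε) * ∫ θ in ω₀..(ω₀ + Δ), ∑ k, rayLength Ω Y k θ ^ 2 / 2 := by
      rw [area, H.volume_sectorShell hh0 hhpi hε.1.le (by linarith [hε.2]) (by linarith [hε.1]),
        hm1, hm2, hr, ENNReal.toReal_ofReal (mul_nonneg h2ε.le hnn)]
    simp only [gradientDensity]
    rw [show area (shrunkRegion Ω Y ε ∩ gradient (distTransform Y) ⁻¹' annularSector m (Δ / 2) δ) =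
      area (sectorShell Ω Y m (Δ / 2) ε (1 - ε)) from congrArg ENNReal.toReal (measure_congr hset),
      hv, hLε, intervalIntegral.integral_const_mul, mul_inv, one_div]
    field_simp
  rw [hlim] at key
  refine key.congr fun τ => ?_
  rw [toReal_lintegral_annularSector hh0 hhpi hδ0 hδ1
    (continuous_wavePower hEm hEb.measure_lt_top.ne hS τ) (wavePower_nonneg τ), hm1, hm2]
  simp only [powerSpectrum_eq_wavePower hEm]

end Main

end DistanceTransform

end

theorem mainTheorem4 (K : ℕ) (hK : 1 ≤ K)
    (Y : Fin K → DistanceTransform.Plane) (hY : Function.Injective Y)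
    (Ω : Set DistanceTransform.Plane) (hΩ : DistanceTransform.IsPolygonalRegion Ω)
    (hYΩ : ∀ k, Y k ∈ interior Ω)
    (hconv : ∀ k, Convex ℝ (DistanceTransform.voronoiCell Ω Y k))
    (δ : ℝ) (hδ0 : 0 < δ) (hδ1 : δ < 1) (ω₀ : ℝ) :
    Tendsto (fun Δ : ℝ => DistanceTransform.orientationProb Ω Y ω₀ Δ / Δ) (𝓝[>] 0)
      (𝓝 (DistanceTransform.gradientDensity Ω Y ω₀)) ∧
    ∃ (G : ℝ → ℝ → ℝ) (H : ℝ → ℝ),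
      (∀ ε ∈ Set.Ioo (0 : ℝ) (1 / 2), ∀ Δ ∈ Set.Ioo (0 : ℝ) (2 * Real.pi),
        Tendsto
          (fun τ : ℝ => ∫ ω in ω₀..(ω₀ + Δ), ∫ r in (1 - δ)..(1 + δ),
            DistanceTransform.powerSpectrum Ω Y ε τ r ω * r)
          (𝓝[>] 0) (𝓝 (G ε Δ))) ∧
      (∀ ε ∈ Set.Ioo (0 : ℝ) (1 / 2),
        Tendsto (fun Δ : ℝ => 1 / Δ * G ε Δ) (𝓝[>] 0) (𝓝 (H ε))) ∧
      Tendsto H (𝓝[>] 0) (𝓝 (DistanceTransform.gradientDensity Ω Y ω₀)) := by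
  have HV : DistanceTransform.IsConvexVoronoi Ω Y := ⟨hY, hΩ.1, hYΩ, hconv⟩
  have hav := DistanceTransform.tendsto_average_of_continuous HV.continuous_gradientDensity ω₀
  -- The witness for the limit over `τ` does not depend on `ε`, so the one for the limit over `Δ` is
  -- constant.
  refine ⟨hav.congr' ?_, fun _ Δ => ∫ φ in ω₀..(ω₀ + Δ), DistanceTransform.gradientDensity Ω Y φ,
    fun _ => DistanceTransform.gradientDensity Ω Y ω₀, ?_, ?_, tendsto_const_nhds⟩
  · filter_upwards [Ioo_mem_nhdsGT Real.two_pi_pos] with Δ hΔ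
    rw [HV.orientationProb_eq hK ω₀ hΔ]
  · exact fun ε hε Δ hΔ => HV.tendsto_integral_powerSpectrum hK hδ0 hδ1 ω₀ hε hΔ
  · exact fun _ _ => hav.congr fun Δ => by rw [one_div, div_eq_inv_mul]
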